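/- Let $R$ be a commutative Noetherian local ring with maximal ideal $\mathfrak m$, and let $M,N$ be finitely generated $R$-modules. The depth of a finitely generated nonzero $R$-module is the supremum of the lengths of its regular sequences contained in $\mathfrak m$, and the zero module has depth $\infty$. Let $\operatorname{Ass}$ denote the set of associated primes, and $\operatorname{Min}(N)$ the set of primes minimal over $I:=\operatorname{Ann}_R(N)$. Let $t,s,r$ be non-negative integers with $s\ge t$, and assume that $$\operatorname{depth}(M)\ge t,\qquad \operatorname{depth}(N)=t,\qquad \operatorname{Ass}(N)=\operatorname{Min}(N),$$ that $\operatorname{Ext}^i_R(M,N)=0$ for all $1\le i\le s$, and that $\operatorname{Hom}_R(M,N)\cong N^r$ as $R$-modules. Then $$M/IM\cong (R/I)^r .$$ Furthermore, if one of the following holds: 1. $N$ is faithful, i.e. $I=0$; 2. $\operatorname{Ass}(R)\subseteq\operatorname{Ass}(N)$ and $s>0$; then $M\cong R^r$. -/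

import Mathlib

universe u v

/-- The depth of a finitely generated module `M` over a Noetherian local ring `R`: the supremum of
the lengths of the `M`-regular sequences contained in the maximal ideal of `R`, with the usual
convention that the zero module has depth `∞`. (`RingTheory.Sequence.IsRegular M rs` includes the
condition `M ≠ (rs) M`.) -/
noncomputable def moduleDepth (R : Type u) [CommRing R] [IsLocalRing R]
    (M : Type v) [AddCommGroup M] [Module R M] : ℕ∞ :=
  open Classical in
  if Subsingleton M then ⊤
  else ⨆ (rs : List R) (_ : RingTheory.Sequence.IsRegular M rs)
    (_ : ∀ x ∈ rs, x ∈ IsLocalRing.maximalIdeal R), (rs.length : ℕ∞)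

/-- `Min(M)`: the minimal primes of a finitely generated module `M`, that is, the primes minimal
among those containing the annihilator of `M` (equivalently, the minimal elements of the
support of `M`). -/
def moduleMinimalPrimes (R : Type u) [CommRing R]
    (M : Type v) [AddCommGroup M] [Module R M] : Set (Ideal R) :=
  (Module.annihilator R M).minimalPrimes

/-!
Write `k` for the residue field and `I` for the annihilator of `N`.

*The number of generators of `M` is `r`.* If the socle `Hom(k, N)` is nonzero, this follows from
`Hom(k, Hom(M, N)) ≅ Hom(k ⊗ M, N)`: the left side is the `r`-th power of the socle and the right
side its `dim (k ⊗ M)`-th power. In general choose a maximal regular sequence on `N`, of length `t`.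
For an `N`-regular element `x`, the long exact sequence of `0 → N → N → N/xN → 0` shows that both the
isomorphism `Hom(M, N) ≅ Nʳ` and the vanishing of `Ext`, in one degree fewer, pass to `N/xN`; after
`t` steps the socle is nonzero (`finrank_residueField_tensor_eq_of_ext_vanishing`).

*The relations of `M` lie in `I Rʳ`.* Let `K` be the kernel of a surjection `Rʳ → M`. Then
`0 → Hom(M, N) → Nʳ → Hom(K, N)` is exact, and the first map becomes an injective endomorphism `φ` of
`Nʳ`. Its cokernel embeds into `Hom(K, N)`, so its associated primes lie in `Ass N = Min N`. At a
minimal prime of `N` the module `Nʳ` has finite length, so there `φ` is surjective; hence `φ` is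
surjective (`surjective_of_injective_of_associatedPrimes_subset`). Therefore every map `Rʳ → N`
kills `K`, which means that `K ⊆ I Rʳ`, and `M/IM ≅ (R/I)ʳ`.

*The case where `M` is free.* If `I = 0`, then `K = 0`. If `Ext¹(M, N) = 0`, every map `K → N` extends to
`Rʳ`, so `Hom(K, N) = 0`; when moreover `Ass R ⊆ Ass N`, this forces `K = 0`
(`subsingleton_of_injective_pi_of_subsingleton_linearMap`).
-/

open CategoryTheory Abelian IsLocalRing TensorProduct Pointwise

/-! ### Powers of modules and numbers of generators over a local ring -/

theorem nonempty_linearEquiv_of_ker_eq {R P A B : Type*} [CommRing R] [AddCommGroup P]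
    [AddCommGroup A] [AddCommGroup B] [Module R P] [Module R A] [Module R B]
    {u : P →ₗ[R] A} {v : P →ₗ[R] B} (hu : Function.Surjective u) (hv : Function.Surjective v)
    (h : LinearMap.ker u = LinearMap.ker v) : Nonempty (A ≃ₗ[R] B) :=
  ⟨(u.quotKerEquivOfSurjective hu).symm ≪≫ₗ Submodule.quotEquivOfEq _ _ h ≪≫ₗ
    v.quotKerEquivOfSurjective hv⟩

/-- Invariance of the rank for powers of a nonzero module over a local ring. -/
theorem eq_of_linearEquiv_pi {R S : Type*} [CommRing R] [IsLocalRing R] [AddCommGroup S]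
    [Module R S] [Module.Finite R S] [Nontrivial S] {m n : ℕ}
    (e : (Fin m → S) ≃ₗ[R] (Fin n → S)) : m = n := by
  let k := ResidueField R
  have key (l : ℕ) : Module.finrank k (k ⊗[R] (Fin l → S)) = l * Module.finrank k (k ⊗[R] S) := by
    rw [(TensorProduct.piRight R k k (fun _ : Fin l => S)).finrank_eq, Module.finrank_pi_fintype]
    simp
  have h := (e.baseChange R k _ _).finrank_eq
  rw [key, key] at h
  have : Nontrivial (k ⊗[R] S) := by
    rw [← not_subsingleton_iff_nontrivial, IsLocalRing.subsingleton_tensorProduct]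
    exact not_subsingleton S
  exact Nat.eq_of_mul_eq_mul_right (Module.finrank_pos) h

/-- If `Hom(M, N) ≅ Nʳ` and `N` has nonzero socle, then `M` is minimally generated by `r`
elements: both sides of `Hom(k, Hom(M, N)) ≅ Hom(k ⊗ M, N)` are powers of `Hom(k, N)`. -/
theorem finrank_residueField_tensor_eq_of_linearEquiv_pi {R M N : Type*} [CommRing R]
    [IsLocalRing R] [IsNoetherianRing R] [AddCommGroup M] [Module R M] [Module.Finite R M]
    [AddCommGroup N] [Module R N] [Module.Finite R N] [Nontrivial (ResidueField R →ₗ[R] N)] {r : ℕ}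
    (e : (M →ₗ[R] N) ≃ₗ[R] (Fin r → N)) :
    Module.finrank (ResidueField R) (ResidueField R ⊗[R] M) = r := by
  let k := ResidueField R
  let b : k ⊗[R] M ≃ₗ[R] (Fin (Module.finrank k (k ⊗[R] M)) → k) :=
    (Module.finBasis k (k ⊗[R] M)).equivFun.restrictScalars R
  exact eq_of_linearEquiv_pi (R := R) (S := k →ₗ[R] N)
    ((LinearMap.lsum R (fun _ => k) R) ≪≫ₗ (b.congrLeft N R).symm ≪≫ₗ
      (TensorProduct.lift.equiv (.id R) k M N).symm ≪≫ₗ e.congrRight ≪≫ₗ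
      { LinearMap.pi (fun i => LinearMap.llcomp R k (Fin r → N) N (LinearMap.proj i)) with
          invFun := LinearMap.pi
          left_inv := fun _ => rfl
          right_inv := fun _ => rfl })

/-- Nakayama: lifts of a basis of `k ⊗ M` generate `M`. -/
theorem exists_surjective_of_finrank_residueField_tensor {R M : Type*} [CommRing R]
    [IsLocalRing R] [AddCommGroup M] [Module R M] [Module.Finite R M] {n : ℕ}
    (h : Module.finrank (ResidueField R) (ResidueField R ⊗[R] M) = n) :
    ∃ π : (Fin n → R) →ₗ[R] M, Function.Surjective π := by
  let k := ResidueField R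
  let b : Module.Basis (Fin n) k (k ⊗[R] M) := Module.finBasisOfFinrankEq k _ h
  have hsurj := TensorProduct.mk_surjective R M k residue_surjective
  choose f hf using fun i => hsurj (b i)
  refine ⟨Fintype.linearCombination R f, ?_⟩
  rw [← LinearMap.range_eq_top, Fintype.range_linearCombination]
  exact span_eq_top_of_tmul_eq_basis f b hf

theorem mem_ideal_smul_top_pi_iff {R ι : Type*} [CommRing R] [Finite ι] {I : Ideal R} {x : ι → R} :
    x ∈ (I • ⊤ : Submodule R (ι → R)) ↔ ∀ i, x i ∈ I := by
  classical
  cases nonempty_fintype ι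
  refine ⟨fun hx i => ?_, fun hx => ?_⟩
  · refine Submodule.smul_induction_on hx (fun a ha y _ => I.mul_mem_right (y i) ha)
      fun y z hy hz => I.add_mem hy hz
  · rw [pi_eq_sum_univ x]
    exact Submodule.sum_mem _ fun i _ => Submodule.smul_mem_smul (hx i) Submodule.mem_top

/-! ### Associated primes and injective endomorphisms -/

section

variable {R : Type*} [CommRing R] [IsNoetherianRing R]

/-- An injective endomorphism of a finitely generated module becomes surjective after localizing at a
minimal prime of the ring, because the localized module is Artinian. -/
theorem exists_smul_mem_range_of_mem_minimalPrimes {P : Type*} [AddCommGroup P]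
    [Module R P] [Module.Finite R P] {p : Ideal R} (hp : p ∈ minimalPrimes R) {f : P →ₗ[R] P}
    (hf : Function.Injective f) (x : P) : ∃ a ∉ p, a • x ∈ LinearMap.range f := by
  have : p.IsPrime := hp.1.1
  have : Ring.KrullDimLE 0 (Localization p.primeCompl) :=
    .of_isLocalization p hp (Localization.AtPrime p)
  have : IsNoetherianRing (Localization p.primeCompl) :=
    IsLocalization.isNoetherianRing p.primeCompl _ inferInstance
  have : IsArtinianRing (Localization p.primeCompl) :=
    isArtinianRing_iff_isNoetherianRing_krullDimLE_zero.mpr ⟨inferInstance, inferInstance⟩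
  let F := LocalizedModule.map p.primeCompl f
  have hF : Function.Surjective F :=
    IsArtinian.surjective_of_injective_endomorphism F
      (LocalizedModule.map_injective p.primeCompl f hf)
  obtain ⟨y, hy⟩ := hF (LocalizedModule.mk x 1)
  induction y using LocalizedModule.induction_on with | _ y s
  rw [LocalizedModule.map_mk, LocalizedModule.mk_eq] at hy
  obtain ⟨c, hc⟩ := hy
  refine ⟨c * s, (c * s).2, c • y, ?_⟩
  rw [Submonoid.smul_def, map_smul, mul_smul]
  simpa [Submonoid.smul_def] using hc

/-- The same for a prime minimal over an ideal that kills the module, by passing to `R ⧸ I`. -/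
theorem exists_smul_mem_range_of_mem_minimalPrimes_of_le_annihilator {P : Type*} [AddCommGroup P]
    [Module R P] [Module.Finite R P] {I p : Ideal R} (hI : I ≤ Module.annihilator R P)
    (hp : p ∈ I.minimalPrimes) {f : P →ₗ[R] P} (hf : Function.Injective f) (x : P) :
    ∃ a ∉ p, a • x ∈ LinearMap.range f := by
  have htor : Module.IsTorsionBySet R P I :=
    fun x a => Module.mem_annihilator.mp (hI a.2) x
  let : Module (R ⧸ I) P := htor.module
  have : IsScalarTower R (R ⧸ I) P := htor.isScalarTower
  have : Module.Finite (R ⧸ I) P := Module.Finite.of_restrictScalars_finite R _ _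
  rw [Ideal.minimalPrimes_eq_comap] at hp
  obtain ⟨q, hq, rfl⟩ := hp
  let g : P →ₗ[R ⧸ I] P := f.extendScalarsOfSurjective Ideal.Quotient.mk_surjective
  obtain ⟨a, ha, y, hy⟩ := exists_smul_mem_range_of_mem_minimalPrimes hq (f := g) hf x
  obtain ⟨a, rfl⟩ := Ideal.Quotient.mk_surjective a
  exact ⟨a, ha, y, hy⟩

/-- The cokernel of an injective endomorphism of `P` vanishes at every prime minimal over `I`, so it
has no associated prime if all of them are of this kind. -/
theorem surjective_of_injective_of_associatedPrimes_subset {P : Type*} [AddCommGroup P]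
    [Module R P] [Module.Finite R P] {I : Ideal R} (hI : I ≤ Module.annihilator R P)
    {f : P →ₗ[R] P} (hf : Function.Injective f)
    (h : associatedPrimes R (P ⧸ LinearMap.range f) ⊆ I.minimalPrimes) :
    Function.Surjective f := by
  rw [← LinearMap.range_eq_top, ← Submodule.Quotient.subsingleton_iff]
  by_contra hne
  rw [not_subsingleton_iff_nontrivial] at hne
  obtain ⟨p, hp⟩ := associatedPrimes.nonempty R (P ⧸ LinearMap.range f)
  obtain ⟨-, c, hc⟩ := isAssociatedPrime_iff.mp hp
  obtain ⟨x, rfl⟩ := Submodule.mkQ_surjective _ c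
  obtain ⟨a, ha, hax⟩ :=
    exists_smul_mem_range_of_mem_minimalPrimes_of_le_annihilator hI (h hp) hf x
  apply ha
  rw [hc, Submodule.mem_colon_singleton, ← map_smul,
    Submodule.mem_bot, Submodule.mkQ_apply, Submodule.Quotient.mk_eq_zero]
  exact hax

/-- The annihilator of `g : K → N` is the intersection of the annihilators of `g x` for `x` in a finite
generating set of `K`; if it is prime, it equals one of them. -/
theorem associatedPrimes_linearMap_subset {K N : Type*} [AddCommGroup K] [Module R K]
    [Module.Finite R K] [AddCommGroup N] [Module R N] :
    associatedPrimes R (K →ₗ[R] N) ⊆ associatedPrimes R N := by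
  intro p hp
  obtain ⟨hprime, g, hg⟩ := isAssociatedPrime_iff.mp hp
  obtain ⟨S, hS⟩ := Module.Finite.fg_top (R := R) (M := K)
  have hle : S.inf (fun x => Submodule.colon (⊥ : Submodule R N) {g x}) ≤ p := by
    intro a ha
    rw [hg, Submodule.mem_colon_singleton, Submodule.mem_bot]
    refine LinearMap.ext_on (s := (S : Set K)) hS fun x hx => ?_
    simpa [Submodule.mem_colon_singleton] using (Submodule.mem_finsetInf.mp ha) x hx
  obtain ⟨x, -, hx⟩ := (Ideal.IsPrime.inf_le' hprime).mp hle
  refine isAssociatedPrime_iff.mpr ⟨hprime, g x, le_antisymm (fun a ha => ?_) hx⟩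
  rw [hg, Submodule.mem_colon_singleton, Submodule.mem_bot] at ha
  rw [Submodule.mem_colon_singleton, Submodule.mem_bot, ← LinearMap.smul_apply, ha]
  rfl

/-- If `Hom(K, N) = 0`, then some `N`-regular element `a` kills `K`. Since `Ass R ⊆ Ass N`, this `a` is
also regular on `R`, so it kills no nonzero submodule of a free module. -/
theorem subsingleton_of_injective_pi_of_subsingleton_linearMap {K N : Type*} [AddCommGroup K]
    [Module R K] [Module.Finite R K] [AddCommGroup N] [Module R N] [Module.Finite R N]
    (hAss : associatedPrimes R R ⊆ associatedPrimes R N) [Subsingleton (K →ₗ[R] N)]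
    {ι : Type*} {i : K →ₗ[R] (ι → R)} (hi : Function.Injective i) : Subsingleton K := by
  obtain ⟨a, ha, hreg⟩ := IsSMulRegular.subsingleton_linearMap_iff.mp ‹Subsingleton (K →ₗ[R] N)›
  have haR : IsSMulRegular R a := by
    by_contra hcon
    have : a ∈ ⋃ p ∈ associatedPrimes R R, (p : Set R) := by
      rw [biUnion_associatedPrimes_eq_compl_regular]; exact hcon
    have : a ∈ ⋃ p ∈ associatedPrimes R N, (p : Set R) :=
      Set.biUnion_subset_biUnion_left hAss this
    rw [biUnion_associatedPrimes_eq_compl_regular] at this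
    exact this hreg
  refine subsingleton_of_forall_eq 0 fun x => hi ?_
  rw [map_zero]
  funext j
  apply haR
  have := congrFun (congrArg i (Module.mem_annihilator.mp ha x)) j
  simpa using this

end

/-! ### Lifting and extending maps when `Ext¹` vanishes -/

section

variable {R : Type u} [CommRing R]

theorem exists_mkQ_comp_eq_of_subsingleton_ext {M N : Type u} [AddCommGroup M] [Module R M]
    [AddCommGroup N] [Module R N] {x : R} (hx : IsSMulRegular N x)
    [h : Subsingleton (Ext (ModuleCat.of R M) (ModuleCat.of R N) 1)]
    (g : M →ₗ[R] QuotSMulTop x N) :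
    ∃ f : M →ₗ[R] N, (x • (⊤ : Submodule R N)).mkQ ∘ₗ f = g := by
  have hS := IsSMulRegular.smulShortComplex_shortExact (M := ModuleCat.of R N) hx
  obtain ⟨y, hy⟩ := Ext.covariant_sequence_exact₃ (X := ModuleCat.of R M) hS
    (Ext.mk₀ (ModuleCat.ofHom g)) (zero_add 1) (h.elim _ _)
  obtain ⟨f, rfl⟩ := Ext.addEquiv₀.symm.surjective y
  rw [Ext.addEquiv₀_symm_apply, Ext.mk₀_comp_mk₀] at hy
  exact ⟨f.hom, congrArg ModuleCat.Hom.hom (Ext.addEquiv₀.symm.injective hy)⟩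

theorem subsingleton_ext_quotSMulTop {M N : Type u} [AddCommGroup M] [Module R M]
    [AddCommGroup N] [Module R N] {x : R} (hx : IsSMulRegular N x) {i : ℕ}
    [h₀ : Subsingleton (Ext (ModuleCat.of R M) (ModuleCat.of R N) i)]
    [h₁ : Subsingleton (Ext (ModuleCat.of R M) (ModuleCat.of R N) (i + 1))] :
    Subsingleton (Ext (ModuleCat.of R M) (ModuleCat.of R (QuotSMulTop x N)) i) := by
  have hS := IsSMulRegular.smulShortComplex_shortExact (M := ModuleCat.of R N) hx
  refine subsingleton_of_forall_eq 0 fun z => ?_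
  obtain ⟨y, hy⟩ := Ext.covariant_sequence_exact₃ (X := ModuleCat.of R M) hS z rfl (h₁.elim _ _)
  obtain rfl : y = 0 := h₀.elim _ _
  exact hy.symm.trans (Ext.zero_comp _ _ _ _ _)

theorem exists_extension_of_subsingleton_ext {F M N : Type u} [AddCommGroup F] [Module R F]
    [AddCommGroup M] [Module R M] [AddCommGroup N] [Module R N]
    {π : F →ₗ[R] M} (hπ : Function.Surjective π)
    [h : Subsingleton (Ext (ModuleCat.of R M) (ModuleCat.of R N) 1)]
    (g : LinearMap.ker π →ₗ[R] N) : ∃ f : F →ₗ[R] N, f ∘ₗ (LinearMap.ker π).subtype = g := by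
  let S := ModuleCat.shortComplexOfCompEqZero (LinearMap.ker π).subtype π
    (LinearMap.exact_subtype_ker_map π).linearMap_comp_eq_zero
  have hS : S.ShortExact :=
    { exact := ModuleCat.shortComplex_exact S (LinearMap.exact_subtype_ker_map π)
      mono_f := (ModuleCat.mono_iff_injective _).mpr (Submodule.subtype_injective _)
      epi_g := (ModuleCat.epi_iff_surjective _).mpr hπ }
  obtain ⟨y, hy⟩ := Ext.contravariant_sequence_exact₁ hS (ModuleCat.of R N)
    (Ext.mk₀ (ModuleCat.ofHom g)) (add_zero 1) (h.elim _ _)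
  obtain ⟨f, rfl⟩ := Ext.addEquiv₀.symm.surjective y
  rw [Ext.addEquiv₀_symm_apply, Ext.mk₀_comp_mk₀] at hy
  exact ⟨f.hom, congrArg ModuleCat.Hom.hom (Ext.addEquiv₀.symm.injective hy)⟩

end

/-! ### Reduction modulo a regular sequence -/

section

open RingTheory.Sequence

/-- A finite depth is attained by a regular sequence in the maximal ideal, and such a sequence cannot be
extended. -/
theorem exists_maximal_isWeaklyRegular_of_moduleDepth_eq {R : Type u} [CommRing R] [IsLocalRing R]
    {N : Type v} [AddCommGroup N] [Module R N] [Module.Finite R N] {t : ℕ}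
    (h : moduleDepth R N = t) :
    ∃ rs : List R, rs.length = t ∧ IsWeaklyRegular N rs ∧
      ∀ x ∈ maximalIdeal R, ¬ IsWeaklyRegular N (rs ++ [x]) := by
  classical
  by_cases hsub : Subsingleton N
  · rw [moduleDepth, if_pos hsub] at h
    exact absurd h.symm (ENat.natCast_ne_top t)
  rw [moduleDepth, if_neg hsub] at h
  have hnt : Nontrivial N := not_subsingleton_iff_nontrivial.mp hsub
  have hle (rs : List R) (hrs : IsRegular N rs) (hm : ∀ x ∈ rs, x ∈ maximalIdeal R) :
      rs.length ≤ t := by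
    have : (rs.length : ℕ∞) ≤ t := h ▸ le_iSup₂_of_le rs hrs (le_iSup_of_le hm le_rfl)
    exact_mod_cast this
  obtain ⟨rs, hrs, hm, hlen⟩ : ∃ rs : List R, IsRegular N rs ∧
      (∀ x ∈ rs, x ∈ maximalIdeal R) ∧ rs.length = t := by
    by_contra! hne
    cases t with
    | zero => exact hne [] (.nil R N) (by simp) rfl
    | succ n =>
      have : ((n + 1 : ℕ) : ℕ∞) ≤ n := by
        rw [← h]
        refine iSup₂_le fun rs hrs => iSup_le fun hm => ?_
        have h₁ := hle rs hrs hm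
        have h₂ := hne rs hrs hm
        exact_mod_cast (by omega : rs.length ≤ n)
      have : n + 1 ≤ n := by exact_mod_cast this
      omega
  refine ⟨rs, hlen, hrs.toIsWeaklyRegular, fun x hx hreg => ?_⟩
  have hm' : ∀ y ∈ rs ++ [x], y ∈ maximalIdeal R := by
    intro y hy
    rcases List.mem_append.mp hy with hy | hy
    · exact hm y hy
    · rwa [List.mem_singleton.mp hy]
  have := hle _ (IsRegular.of_isWeaklyRegular_of_mem_maximalIdeal N hm' hreg) hm'
  simp [hlen] at this

/-- If `x` is `N`-regular and `Ext¹(M, N) = 0`, then `Hom(M, N/xN) = Hom(M, N)/x Hom(M, N)`, so an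
isomorphism `Hom(M, N) ≅ Nʳ` descends to `N/xN`. -/
theorem nonempty_linearMap_quotSMulTop_equiv_pi {R M N : Type u} [CommRing R] [AddCommGroup M]
    [Module R M] [AddCommGroup N] [Module R N] {r : ℕ} {x : R} (hx : IsSMulRegular N x)
    [Subsingleton (Ext (ModuleCat.of R M) (ModuleCat.of R N) 1)]
    (e : (M →ₗ[R] N) ≃ₗ[R] (Fin r → N)) :
    Nonempty ((M →ₗ[R] QuotSMulTop x N) ≃ₗ[R] (Fin r → QuotSMulTop x N)) := by
  let q : N →ₗ[R] QuotSMulTop x N := (x • (⊤ : Submodule R N)).mkQ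
  have hq (n : N) : q n = 0 ↔ ∃ m, x • m = n := by
    simp [q, Submodule.mem_smul_pointwise_iff_exists]
  refine nonempty_linearEquiv_of_ker_eq (u := LinearMap.compRight R q)
    (v := q.compLeft (Fin r) ∘ₗ e.toLinearMap)
    (fun g => exists_mkQ_comp_eq_of_subsingleton_ext hx g) ?_ ?_
  · rw [LinearMap.coe_comp]
    exact ((Submodule.mkQ_surjective _).comp_left).comp e.surjective
  · ext g
    rw [LinearMap.mem_ker, LinearMap.mem_ker]
    constructor
    · intro hg
      have hg' (m : M) : ∃ n, x • n = g m := (hq _).mp (LinearMap.congr_fun hg m)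
      choose h hh using hg'
      let f : M →ₗ[R] N :=
        { toFun := h
          map_add' := fun a b => hx (by simp only [smul_add, hh, map_add])
          map_smul' := fun a b => hx (by
            simp only [RingHom.id_apply, smul_comm x a, hh, map_smul]) }
      have : g = x • f := LinearMap.ext fun m => (hh m).symm
      funext i
      exact (hq _).mpr ⟨e f i, by rw [this, map_smul]; rfl⟩
    · intro hg
      have hg' (i : Fin r) : ∃ n, x • n = e g i := (hq _).mp (congrFun hg i)
      choose h hh using hg'
      have : g = x • e.symm h := by
        rw [← map_smul, LinearEquiv.eq_symm_apply]
        exact (funext hh).symm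
      refine LinearMap.ext fun m => (hq _).mpr ⟨e.symm h m, ?_⟩
      rw [this]; rfl

/-- Induction along a maximal regular sequence on `N`: each step replaces `N` by `N/xN`, at the cost of
one vanishing `Ext`, until the socle of `N` is nonzero. -/
theorem finrank_residueField_tensor_eq_of_ext_vanishing {R M : Type u} [CommRing R]
    [IsNoetherianRing R] [IsLocalRing R] [AddCommGroup M] [Module R M] [Module.Finite R M] {r : ℕ}
    (rs : List R) {N : Type u} [AddCommGroup N] [Module R N] [Module.Finite R N]
    (hreg : IsWeaklyRegular N rs)
    (hmax : ∀ x ∈ maximalIdeal R, ¬ IsWeaklyRegular N (rs ++ [x]))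
    (hExt : ∀ i : ℕ, 1 ≤ i → i ≤ rs.length →
      Subsingleton (Ext (ModuleCat.of R M) (ModuleCat.of R N) i))
    (e : (M →ₗ[R] N) ≃ₗ[R] (Fin r → N)) :
    Module.finrank (ResidueField R) (ResidueField R ⊗[R] M) = r := by
  induction rs generalizing N with
  | nil =>
    have : Nontrivial (ResidueField R →ₗ[R] N) := by
      rw [← not_subsingleton_iff_nontrivial, IsSMulRegular.subsingleton_linearMap_iff]
      rintro ⟨x, hx, hxreg⟩
      refine hmax x ?_ ((isWeaklyRegular_singleton_iff N x).mpr hxreg)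
      have hann : Module.annihilator R (ResidueField R) = maximalIdeal R :=
        Ideal.annihilator_quotient
      rwa [← hann]
    exact finrank_residueField_tensor_eq_of_linearEquiv_pi e
  | cons x rs ih =>
    obtain ⟨hx, hrs⟩ := (isWeaklyRegular_cons_iff N x rs).mp hreg
    have := hExt 1 le_rfl (by simp)
    obtain ⟨e'⟩ := nonempty_linearMap_quotSMulTop_equiv_pi hx e
    refine ih hrs (fun y hy h => hmax y hy (IsWeaklyRegular.cons hx h)) (fun i h₁ h₂ => ?_) e'
    have := hExt i h₁ (by simp; omega)
    have := hExt (i + 1) (by omega) (by simp; omega)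
    exact subsingleton_ext_quotSMulTop hx

end

/-! ### Modules whose dual into `N` is a power of `N` -/

theorem theorem4p7 {R : Type u} [CommRing R] [IsNoetherianRing R] [IsLocalRing R]
    {M N : Type u} [AddCommGroup M] [Module R M] [Module.Finite R M]
    [AddCommGroup N] [Module R N] [Module.Finite R N]
    (t s r : ℕ)
    (hM : (t : ℕ∞) ≤ moduleDepth R M)
    (hN : moduleDepth R N = (t : ℕ∞))
    (hAss : associatedPrimes R N = moduleMinimalPrimes R N)
    (hst : t ≤ s)
    (hExt : ∀ i : ℕ, 1 ≤ i → i ≤ s →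
      Subsingleton (CategoryTheory.Abelian.Ext (ModuleCat.of R M) (ModuleCat.of R N) i))
    (hHom : Nonempty ((M →ₗ[R] N) ≃ₗ[R] (Fin r → N))) :
    Nonempty ((M ⧸ (Module.annihilator R N • ⊤ : Submodule R M)) ≃ₗ[R]
      (Fin r → R ⧸ Module.annihilator R N)) ∧
    ((Module.annihilator R N = ⊥ ∨
        (associatedPrimes R R ⊆ associatedPrimes R N ∧ 0 < s)) →
      Nonempty (M ≃ₗ[R] (Fin r → R))) := by
  obtain ⟨e⟩ := hHom
  obtain ⟨rs, hlen, hreg, hmax⟩ := exists_maximal_isWeaklyRegular_of_moduleDepth_eq hN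
  obtain ⟨π, hπ⟩ := exists_surjective_of_finrank_residueField_tensor
    (finrank_residueField_tensor_eq_of_ext_vanishing rs hreg hmax
      (fun i h₁ h₂ => hExt i h₁ (by omega)) e)
  set I := Module.annihilator R N with hI
  let ε : (Fin r → N) ≃ₗ[R] ((Fin r → R) →ₗ[R] N) := (Module.piEquiv (Fin r) R N)
  -- `Nʳ ≅ Hom(M, N) → Hom(Rʳ, N) ≅ Nʳ`, the middle map being composition with `π`.
  let φ : (Fin r → N) →ₗ[R] (Fin r → N) :=
    ε.symm.toLinearMap ∘ₗ LinearMap.lcomp R N π ∘ₗ e.symm.toLinearMap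
  have hφ : Function.Injective φ :=
    ε.symm.injective.comp ((LinearMap.lcomp_injective_of_surjective π hπ).comp e.symm.injective)
  have hIP : I ≤ Module.annihilator R (Fin r → N) := fun a ha => by
    rw [Module.mem_annihilator]
    intro v
    funext i
    exact Module.mem_annihilator.mp ha (v i)
  -- The restriction map `Nʳ = Hom(Rʳ, N) → Hom(K, N)`, with `K` the module of relations of `M`.
  let ρ : (Fin r → N) →ₗ[R] (LinearMap.ker π →ₗ[R] N) :=
    LinearMap.lcomp R N (LinearMap.ker π).subtype ∘ₗ ε.toLinearMap
  have hρφ : LinearMap.ker ρ = LinearMap.range φ := by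
    ext v
    rw [LinearMap.mem_ker, LinearMap.mem_range]
    constructor
    · intro hv
      have hker : LinearMap.ker π ≤ LinearMap.ker (ε v) := fun x hx =>
        LinearMap.congr_fun hv (⟨x, hx⟩ : LinearMap.ker π)
      let g : M →ₗ[R] N := (LinearMap.ker π).liftQ (ε v) hker ∘ₗ
        (π.quotKerEquivOfSurjective hπ).symm.toLinearMap
      refine ⟨e g, ?_⟩
      simp only [φ, LinearMap.comp_apply, LinearEquiv.coe_coe, LinearEquiv.symm_apply_apply]
      rw [LinearEquiv.symm_apply_eq]
      refine LinearMap.ext fun x => ?_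
      have : (π.quotKerEquivOfSurjective hπ).symm (π x) = (LinearMap.ker π).mkQ x := by
        rw [LinearEquiv.symm_apply_eq]; rfl
      simp [g, this]
    · rintro ⟨w, rfl⟩
      refine LinearMap.ext fun x => ?_
      have := x.2
      rw [LinearMap.mem_ker] at this
      simp [ρ, φ, this]
  -- The cokernel of `φ` embeds into `Hom(K, N)`, which bounds its associated primes.
  have hquot : Function.Injective ((LinearMap.range φ).liftQ ρ hρφ.ge) :=
    LinearMap.ker_eq_bot.mp (Submodule.ker_liftQ_eq_bot _ _ _ hρφ.le)
  have hAssQ : associatedPrimes R ((Fin r → N) ⧸ LinearMap.range φ) ⊆ I.minimalPrimes :=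
    (associatedPrimes.subset_of_injective hquot).trans
      (associatedPrimes_linearMap_subset.trans hAss.le)
  have hφs : Function.Surjective φ :=
    surjective_of_injective_of_associatedPrimes_subset hIP hφ hAssQ
  have hρ : ρ = 0 := by
    rw [← LinearMap.ker_eq_top, hρφ, LinearMap.range_eq_top.mpr hφs]
  -- Every map `Rʳ → N` kills the relations of `M`, so their coordinates kill `N`.
  have hK (x : Fin r → R) (hx : π x = 0) (i : Fin r) : x i ∈ I := by
    rw [hI, Module.mem_annihilator]
    intro n
    have := LinearMap.congr_fun (LinearMap.congr_fun hρ (Pi.single i n))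
      (⟨x, hx⟩ : LinearMap.ker π)
    simpa [ρ, ε, Module.piEquiv_apply_apply, Pi.single_apply] using this
  refine ⟨?_, ?_⟩
  · refine nonempty_linearEquiv_of_ker_eq (P := Fin r → R)
      (u := (I • ⊤ : Submodule R M).mkQ ∘ₗ π) (v := I.mkQ.compLeft (Fin r)) ?_ ?_ ?_
    · rw [LinearMap.coe_comp]
      exact (Submodule.mkQ_surjective _).comp hπ
    · exact (Submodule.mkQ_surjective _).comp_left
    · ext x
      have hv : x ∈ LinearMap.ker (I.mkQ.compLeft (Fin r)) ↔ ∀ i, x i ∈ I := by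
        simp [LinearMap.mem_ker, funext_iff, Ideal.Quotient.eq_zero_iff_mem]
      rw [hv, LinearMap.mem_ker, LinearMap.comp_apply, Submodule.mkQ_apply,
        Submodule.Quotient.mk_eq_zero]
      have himage : (I • ⊤ : Submodule R M) = (I • ⊤ : Submodule R (Fin r → R)).map π := by
        rw [Submodule.map_smul'', Submodule.map_top, LinearMap.range_eq_top.mpr hπ]
      rw [himage, ← mem_ideal_smul_top_pi_iff]
      constructor
      · rintro ⟨y, hy, hxy⟩
        have := hK (x - y) (by rw [map_sub, hxy, sub_self])
        simpa using add_mem (mem_ideal_smul_top_pi_iff.mpr this) hy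
      · exact fun hx => ⟨x, hx, rfl⟩
  · intro hcase
    suffices hker : LinearMap.ker π = ⊥ from
      ⟨(LinearEquiv.ofBijective π ⟨LinearMap.ker_eq_bot.mp hker, hπ⟩).symm⟩
    rcases hcase with h0 | ⟨hR, hs⟩
    · rw [LinearMap.ker_eq_bot']
      intro x hx
      funext i
      simpa [h0] using hK x hx i
    · have := hExt 1 le_rfl hs
      have : Subsingleton (LinearMap.ker π →ₗ[R] N) := by
        refine subsingleton_of_forall_eq 0 fun g => ?_
        obtain ⟨f, rfl⟩ := exists_extension_of_subsingleton_ext hπ g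
        have := LinearMap.congr_fun hρ (ε.symm f)
        rw [LinearMap.comp_apply, LinearEquiv.coe_coe, LinearEquiv.apply_symm_apply] at this
        exact this
      rw [← Submodule.subsingleton_iff_eq_bot]
      exact subsingleton_of_injective_pi_of_subsingleton_linearMap hR
        (Submodule.subtype_injective (LinearMap.ker π))
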